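/- Let $\mathcal{N}$ be a finite set of agents, each agent $k$ having a finite nonempty action set $S_k$. Let $\mathcal{E}$ be an undirected network without loops on $\mathcal{N}$ with symmetric $0/1$ adjacency matrix $G$; let $\mathcal{N}_k$ be the set of neighbours of $k$, and let every edge $(k,l)$ carry payoff matrices $A^{kl}\in\mathbb{R}^{S_k\times S_l}$, $A^{lk}\in\mathbb{R}^{S_l\times S_k}$. Let $\Delta=\prod_k\Delta(S_k)$ be the set of joint mixed strategies. The payoff of agent $k$ is $u_k(\mathbf{x})=\sum_{l\in\mathcal{N}_k}\mathbf{x}_k\cdot A^{kl}\mathbf{x}_l$, and its reward for action $i$ is $r_{ki}(\mathbf{x}_{-k})=\partial u_k/\partial x_{ki}=\sum_{l\in\mathcal{N}_k}(A^{kl}\mathbf{x}_l)_i$. The influence bound $\delta_k$ is the maximum of $|r_{ki}(a_{-k})-r_{ki}(\tilde a_{-k})|$ over $i\in S_k$ and pure strategies $a_{-k},\tilde a_{-k}$ that differ only in the action of one agent $l\in\mathcal{N}_k$. The intensity of identical interests is $\sigma_I=\max_{(k,l)\in\mathcal{E}}\|A^{kl}+(A^{lk})^\top\|_2$, where $\|\cdot\|_2$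 is the operator $2$-norm. (Maxima over an empty set are $0$.) Further, $\|M\|_\infty=\max_i\sum_j|M_{ij}|$. For exploration rates $T_k$, a Quantal Response Equilibrium (QRE) is a point $\bar{\mathbf{x}}\in\Delta$ with $$\bar x_{ki}=\frac{\exp(r_{ki}(\bar{\mathbf{x}}_{-k})/T_k)}{\sum_{j\in S_k}\exp(r_{kj}(\bar{\mathbf{x}}_{-k})/T_k)}\quad\text{for all }k,\ i,$$ and the Q-Learning dynamics are the differential equation $$\frac{\dot x_{ki}}{x_{ki}}=r_{ki}(\mathbf{x}_{-k})-\langle\mathbf{x}_k,r_k(\mathbf{x}_{-k})\rangle+T_k\sum_{j\in S_k}x_{kj}\ln\frac{x_{kj}}{x_{ki}}$$ on the relative interior of $\Delta$ (all $x_{ki}>0$). Suppose that at least one of the following holds: - (C1) for all agents $k$: $T_k>\delta_k|\mathcal{N}_k|$; - (C2) for all agents $k$: $T_k>\tfrac12\sigma_I\|G\|_\infty$; - (C3) every edge defines the same bimatrix game $(A,B)$ (up to the enumeration of the actions and the choice of which endpoint is the row player), and for all agents $k$: $T_k>\tfrac12\sigma_I\|G\|_2$. Then the game has exactly one QRE $\bar{\mathbf{x}}\in\Delta$,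 and the Q-Learning dynamics converge to it: from every initial point in the relative interior of $\Delta$ there is a solution for all $t\ge0$, and every such solution satisfies $\mathbf{x}(t)\to\bar{\mathbf{x}}$ as $t\to\infty$. -/

import Mathlib

open scoped Matrix Topology
open Filter

/-- The operator `2`-norm of a real matrix (the operator norm between Euclidean spaces). -/
noncomputable def matrixTwoNorm {m n : Type*} [Fintype m] [Fintype n] [DecidableEq n]
    (M : Matrix m n ℝ) : ℝ :=
  ‖LinearMap.toContinuousLinearMap (Matrix.toEuclideanLin M)‖

/-- The operator `∞`-norm of a real matrix, i.e. its maximal absolute row sum. -/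
noncomputable def matrixInfNorm {m n : Type*} [Fintype n] (M : Matrix m n ℝ) : ℝ :=
  ⨆ i, ∑ j, |M i j|

/-- A network polymatrix game on the agents `V`, agent `k` having the action set `S k`: an
undirected network without loops and, for each edge `(k, l)`, the payoff matrices
`payoffMatrix k l` and `payoffMatrix l k`. The matrices at pairs which are not edges are
never used. -/
structure NetworkGame (V : Type*) (S : V → Type*) where
  graph : SimpleGraph V
  payoffMatrix : ∀ k l, Matrix (S k) (S l) ℝ

namespace NetworkGame

variable {V : Type*} [Fintype V] {S : V → Type*} [∀ k, Fintype (S k)]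

/-- The payoff `u_k(x) = ∑_{l ∈ N_k} x_k · A^{kl} x_l`. -/
def payoff (g : NetworkGame V S) [DecidableRel g.graph.Adj] (k : V) (x : ∀ l, S l → ℝ) : ℝ :=
  ∑ l ∈ g.graph.neighborFinset k, x k ⬝ᵥ (g.payoffMatrix k l *ᵥ x l)

/-- The reward `r_{ki}(x_{-k})` of agent `k` for the action `i`; it does not depend on `x_k`. -/
def reward (g : NetworkGame V S) [DecidableRel g.graph.Adj] (k : V) (x : ∀ l, S l → ℝ)
    (i : S k) : ℝ :=
  ∑ l ∈ g.graph.neighborFinset k, (g.payoffMatrix k l *ᵥ x l) i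

/-- `u_k(x) = ⟨x_k, r_k(x_{-k})⟩`. -/
theorem payoff_eq (g : NetworkGame V S) [DecidableRel g.graph.Adj] (k : V)
    (x : ∀ l, S l → ℝ) : g.payoff k x = ∑ i, x k i * g.reward k x i := by
  simp only [payoff, reward, dotProduct, Finset.mul_sum]
  exact Finset.sum_comm

theorem reward_update (g : NetworkGame V S) [DecidableRel g.graph.Adj] [DecidableEq V] (k : V)
    (x : ∀ l, S l → ℝ) (y : S k → ℝ) (i : S k) :
    g.reward k (Function.update x k y) i = g.reward k x i := by
  refine Finset.sum_congr rfl fun l hl => ?_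
  rw [SimpleGraph.mem_neighborFinset] at hl
  rw [Function.update_of_ne hl.ne']

/-- The reward is the partial derivative `∂u_k / ∂x_{ki}`. -/
theorem hasDerivAt_payoff (g : NetworkGame V S) [DecidableRel g.graph.Adj] [DecidableEq V]
    [∀ k, DecidableEq (S k)] (k : V) (x : ∀ l, S l → ℝ) (i : S k) :
    HasDerivAt (fun t : ℝ => g.payoff k (Function.update x k (Function.update (x k) i t)))
      (g.reward k x i) (x k i) := by
  simp only [payoff_eq, reward_update, Function.update_self]
  have h : ∀ j ∈ Finset.univ, HasDerivAt
      (fun t : ℝ => Function.update (x k) i t j * g.reward k x j)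
      ((if j = i then 1 else 0) * g.reward k x j) (x k i) := by
    intro j _
    by_cases hj : j = i
    · subst hj
      simpa using (hasDerivAt_id (x k j)).mul_const (g.reward k x j)
    · simpa [hj] using hasDerivAt_const (x k i) (x k j * g.reward k x j)
  simpa using HasDerivAt.fun_sum h

/-- `x` lies in the relative interior of `Δ = ×_k Δ(S_k)`: every `x_k` is a probability vector
with full support. -/
def IsInteriorStrategy (x : ∀ k, S k → ℝ) : Prop :=
  ∀ k, (∀ i, 0 < x k i) ∧ ∑ i, x k i = 1

/-- `x` is a quantal response equilibrium for the exploration rates `T`. -/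
def IsQRE (g : NetworkGame V S) [DecidableRel g.graph.Adj] (T : V → ℝ)
    (x : ∀ k, S k → ℝ) : Prop :=
  (∀ k, x k ∈ stdSimplex ℝ (S k)) ∧
    ∀ k i, x k i =
      Real.exp (g.reward k x i / T k) / ∑ j, Real.exp (g.reward k x j / T k)

/-- The influence bound `δ_k`: the largest change of a reward of agent `k` when exactly one
neighbour `l` of `k` changes its action (`0` if `k` has no neighbour). -/
noncomputable def influenceBound (g : NetworkGame V S) [DecidableRel g.graph.Adj]
    [∀ k, DecidableEq (S k)] (k : V) : ℝ :=
  sSup {d : ℝ | ∃ (i : S k) (a b : ∀ m, S m) (l : V), g.graph.Adj k l ∧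
    (∀ m, m ≠ l → a m = b m) ∧
    d = |g.reward k (fun m => Pi.single (a m) 1) i - g.reward k (fun m => Pi.single (b m) 1) i|}

/-- The intensity of identical interests `σ_I` (`0` if the network has no edge). -/
noncomputable def identicalInterest (g : NetworkGame V S) [∀ k, DecidableEq (S k)] : ℝ :=
  sSup {s : ℝ | ∃ k l, g.graph.Adj k l ∧
    s = matrixTwoNorm (g.payoffMatrix k l + (g.payoffMatrix l k)ᵀ)}

/-- The bimatrix game on the pair `(k, l)`, with `k` in the row role, is `(A, B)` in some
enumeration of the two action sets. -/
def PlaysBimatrix (g : NetworkGame V S) (k l : V) {p q : ℕ}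
    (A : Matrix (Fin p) (Fin q) ℝ) (B : Matrix (Fin q) (Fin p) ℝ) : Prop :=
  ∃ (e : S k ≃ Fin p) (f : S l ≃ Fin q),
    g.payoffMatrix k l = A.submatrix e f ∧ g.payoffMatrix l k = B.submatrix f e

/-- Every edge defines the same bimatrix game `(A, B)`; since the network is undirected, either
endpoint of an edge may have the row role. -/
def SameBimatrixGame (g : NetworkGame V S) : Prop :=
  ∃ (p q : ℕ) (A : Matrix (Fin p) (Fin q) ℝ) (B : Matrix (Fin q) (Fin p) ℝ),
    ∀ k l, g.graph.Adj k l → g.PlaysBimatrix k l A B ∨ g.PlaysBimatrix l k A B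

/-- The right-hand side of the Q-Learning dynamics, i.e. `x_{ki}` times
`r_{ki}(x_{-k}) - ⟨x_k, r_k(x)⟩ + T_k ∑_j x_{kj} ln (x_{kj} / x_{ki})`. -/
noncomputable def qldField (g : NetworkGame V S) [DecidableRel g.graph.Adj] (T : V → ℝ)
    (x : ∀ k, S k → ℝ) (k : V) (i : S k) : ℝ :=
  x k i * (g.reward k x i - ∑ j, x k j * g.reward k x j
    + T k * ∑ j, x k j * Real.log (x k j / x k i))

/-- `x` solves the Q-Learning dynamics for all times `t ≥ 0`, inside the relative interior of
`Δ`, where the equation `ẋ_{ki} / x_{ki} = …` makes sense. -/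
def IsQLDSolution (g : NetworkGame V S) [DecidableRel g.graph.Adj] (T : V → ℝ)
    (x : ℝ → ∀ k, S k → ℝ) : Prop :=
  ∀ t, 0 ≤ t → IsInteriorStrategy (x t) ∧
    ∀ k i, HasDerivWithinAt (fun s => x s k i) (g.qldField T (x t) k i) (Set.Ici 0) t

/-- The Q-Learning dynamics converge to a unique QRE: there is exactly one QRE, from every
initial condition in the relative interior of `Δ` there is a solution for all times `t ≥ 0`,
and every such solution converges to the QRE. -/
def QLDConvergesToUniqueQRE (g : NetworkGame V S) [DecidableRel g.graph.Adj]
    (T : V → ℝ) : Prop :=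
  ∃ xbar : ∀ k, S k → ℝ, g.IsQRE T xbar ∧ (∀ y, g.IsQRE T y → y = xbar) ∧
    (∀ x₀ : ∀ k, S k → ℝ, IsInteriorStrategy x₀ → ∃ x, g.IsQLDSolution T x ∧ x 0 = x₀) ∧
    ∀ x, g.IsQLDSolution T x → Tendsto x atTop (𝓝 xbar)

end NetworkGame

/-!
Any of the three conditions makes the relative entropy from an equilibrium `y` a Lyapunov function.
In the coordinates `z` with `x k = softmax (z k)`, the Q-Learning dynamics read `ż = r(x) - T z`.
This equation is globally Lipschitz, so that solutions exist for all times
(`NetworkGame.exists_isQLDSolution`), and along a solution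
(`NetworkGame.IsQRE.hasDerivWithinAt_relEntropy`)

`d/dt KL(y k ‖ x k) = ⟨x k - y k, r_k(x) - r_k(y)⟩ - T k * (KL(y k ‖ x k) + KL(x k ‖ y k))`.

The last term is the dissipation due to exploration. The symmetrized entropy equals
`⟨x k - y k, log (x k) - log (y k)⟩`; it dominates `‖x k - y k‖₂²`, and each of its two summands
dominates `‖x k - y k‖₁² / 4`.

* Under the condition on the influence bounds, `|r_k(x) - r_k(y)|` is at most
  `δ_k * |N_k| / 2 * max_l ‖x l - y l‖₁`, so that whichever of the entropies `KL(y k ‖ x k)` is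
  currently the largest decays exponentially. The same estimate makes the logit best response a
  contraction in the coordinates `z`, which gives the equilibrium.
* Under the conditions on the intensity of identical interests, only the symmetric parts
  `A^{kl} + (A^{lk})ᵀ` enter the sum of the first terms over `k`, which is therefore at most
  `σ_I / 2 * ‖G‖ * ∑ ‖x k - y k‖₂²`, where `‖G‖` may be any bound for the quadratic form of the
  symmetric matrix `G`. So the sum of the entropies decays exponentially. The same one-sided bound
  shows that `x = softmax ((s * r(x) + b) / T)` is solved by at most one `x`, which is Lipschitz in
  `b` uniformly in `s ∈ [0, 1]`; the method of continuity in `s` then yields the equilibrium, without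
  a topological fixed point theorem.

An equilibrium that attracts all solutions is the only one, because equilibria are constant
solutions.
-/

/-! ### Relative entropy and the softmax map -/

/-- The relative entropy (Kullback–Leibler divergence) of two strictly positive vectors on a finite
set. -/
noncomputable def relEntropy {ι : Type*} [Fintype ι] (p q : ι → ℝ) : ℝ :=
  ∑ i, p i * (Real.log (p i) - Real.log (q i))

/-- The logit choice map `z ↦ exp z / ∑ exp z`. -/
noncomputable def softmax {ι : Type*} [Fintype ι] (z : ι → ℝ) (i : ι) : ℝ :=
  Real.exp (z i) / ∑ j, Real.exp (z j)

section Entropy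

variable {ι : Type*} [Fintype ι]

theorem sq_sqrt_sub_sqrt_le {a b : ℝ} (ha : 0 < a) (hb : 0 < b) :
    (√a - √b) ^ 2 ≤ a * (Real.log a - Real.log b) - a + b := by
  have hsa := Real.sqrt_pos.2 ha
  have hsb := Real.sqrt_pos.2 hb
  have h := Real.log_le_sub_one_of_pos (div_pos hsb hsa)
  rw [Real.log_div hsb.ne' hsa.ne', Real.log_sqrt hb.le, Real.log_sqrt ha.le] at h
  have h2 : a * (√b / √a) = √a * √b := by
    nth_rw 1 [← Real.mul_self_sqrt ha.le]
    field_simp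
  have h3 := mul_le_mul_of_nonneg_left h ha.le
  nlinarith [Real.sq_sqrt ha.le, Real.sq_sqrt hb.le]

theorem sq_sub_le_mul_log_sub_log {a b : ℝ} (ha : 0 < a) (hb : 0 < b) (ha1 : a ≤ 1)
    (hb1 : b ≤ 1) : (a - b) ^ 2 ≤ (a - b) * (Real.log a - Real.log b) := by
  wlog hab : b ≤ a generalizing a b
  · linarith [this hb ha hb1 ha1 (le_of_not_ge hab)]
  have h := Real.one_sub_inv_le_log_of_pos (div_pos ha hb)
  rw [Real.log_div ha.ne' hb.ne', inv_div] at h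
  have h2 : a - b ≤ 1 - b / a := by
    rw [one_sub_div ha.ne', le_div_iff₀ ha]
    nlinarith
  nlinarith

theorem sum_sq_sqrt_sub_sqrt_le_relEntropy {p q : ι → ℝ} (hp : ∀ i, 0 < p i)
    (hq : ∀ i, 0 < q i) (hp1 : ∑ i, p i = 1) (hq1 : ∑ i, q i = 1) :
    ∑ i, (√(p i) - √(q i)) ^ 2 ≤ relEntropy p q := by
  have h := Finset.sum_le_sum fun i (_ : i ∈ Finset.univ) => sq_sqrt_sub_sqrt_le (hp i) (hq i)
  rw [Finset.sum_add_distrib, Finset.sum_sub_distrib, hp1, hq1] at h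
  unfold relEntropy
  linarith

theorem relEntropy_nonneg {p q : ι → ℝ} (hp : ∀ i, 0 < p i)
    (hq : ∀ i, 0 < q i) (hp1 : ∑ i, p i = 1) (hq1 : ∑ i, q i = 1) : 0 ≤ relEntropy p q :=
  (Finset.sum_nonneg fun _ _ => sq_nonneg _).trans
    (sum_sq_sqrt_sub_sqrt_le_relEntropy hp hq hp1 hq1)

/-- A weak form of Pinsker's inequality, obtained from the Hellinger distance. -/
theorem sq_sum_abs_sub_le_relEntropy {p q : ι → ℝ} (hp : ∀ i, 0 < p i)
    (hq : ∀ i, 0 < q i) (hp1 : ∑ i, p i = 1) (hq1 : ∑ i, q i = 1) :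
    (∑ i, |p i - q i|) ^ 2 ≤ 4 * relEntropy p q := by
  have h1 : ∀ i, |p i - q i| = |√(p i) - √(q i)| * (√(p i) + √(q i)) := by
    intro i
    rw [← abs_of_nonneg (add_nonneg (Real.sqrt_nonneg (p i)) (Real.sqrt_nonneg (q i))), ← abs_mul]
    congr 1
    nlinarith [Real.sq_sqrt (hp i).le, Real.sq_sqrt (hq i).le]
  have h2 : ∑ i, (√(p i) + √(q i)) ^ 2 ≤ 4 := by
    calc ∑ i, (√(p i) + √(q i)) ^ 2 ≤ ∑ i, (2 * p i + 2 * q i) := by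
          refine Finset.sum_le_sum fun i _ => ?_
          nlinarith [Real.sq_sqrt (hp i).le, Real.sq_sqrt (hq i).le, sq_nonneg (√(p i) - √(q i))]
      _ = 4 := by
          rw [Finset.sum_add_distrib, ← Finset.mul_sum, ← Finset.mul_sum, hp1, hq1]; norm_num
  have h3 := sum_sq_sqrt_sub_sqrt_le_relEntropy hp hq hp1 hq1
  calc (∑ i, |p i - q i|) ^ 2
      = (∑ i, |√(p i) - √(q i)| * (√(p i) + √(q i))) ^ 2 := by simp only [h1]
    _ ≤ (∑ i, |√(p i) - √(q i)| ^ 2) * ∑ i, (√(p i) + √(q i)) ^ 2 :=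
        Finset.sum_mul_sq_le_sq_mul_sq _ _ _
    _ ≤ relEntropy p q * 4 := by
        simp only [sq_abs]
        exact mul_le_mul h3 h2 (Finset.sum_nonneg fun _ _ => sq_nonneg _)
          (relEntropy_nonneg hp hq hp1 hq1)
    _ = 4 * relEntropy p q := mul_comm _ _

theorem relEntropy_add_relEntropy (p q : ι → ℝ) :
    relEntropy q p + relEntropy p q = ∑ i, (p i - q i) * (Real.log (p i) - Real.log (q i)) := by
  rw [relEntropy, relEntropy, ← Finset.sum_add_distrib]
  exact Finset.sum_congr rfl fun i _ => by ring

theorem le_one_of_sum_eq_one {p : ι → ℝ} (hp : ∀ i, 0 < p i) (hp1 : ∑ i, p i = 1) (i : ι) :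
    p i ≤ 1 :=
  hp1 ▸ Finset.single_le_sum (f := p) (fun j _ => (hp j).le) (Finset.mem_univ i)

theorem sum_sq_sub_le_sum_mul_log {p q : ι → ℝ} (hp : ∀ i, 0 < p i)
    (hq : ∀ i, 0 < q i) (hp1 : ∑ i, p i = 1) (hq1 : ∑ i, q i = 1) :
    ∑ i, (p i - q i) ^ 2 ≤ ∑ i, (p i - q i) * (Real.log (p i) - Real.log (q i)) :=
  Finset.sum_le_sum fun i _ => sq_sub_le_mul_log_sub_log (hp i) (hq i)
    (le_one_of_sum_eq_one hp hp1 i) (le_one_of_sum_eq_one hq hq1 i)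

section Softmax

variable [Nonempty ι]

theorem sum_exp_pos (z : ι → ℝ) : 0 < ∑ j, Real.exp (z j) :=
  Finset.sum_pos (fun _ _ => Real.exp_pos _) Finset.univ_nonempty

theorem softmax_pos (z : ι → ℝ) (i : ι) : 0 < softmax z i :=
  div_pos (Real.exp_pos _) (sum_exp_pos z)

theorem sum_softmax (z : ι → ℝ) : ∑ i, softmax z i = 1 := by
  unfold softmax
  rw [← Finset.sum_div, div_self (sum_exp_pos z).ne']

theorem log_softmax (z : ι → ℝ) (i : ι) :
    Real.log (softmax z i) = z i - Real.log (∑ j, Real.exp (z j)) := by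
  rw [softmax, Real.log_div (Real.exp_pos _).ne' (sum_exp_pos z).ne', Real.log_exp]

omit [Nonempty ι] in
theorem softmax_log {p : ι → ℝ} (hp : ∀ i, 0 < p i) (hp1 : ∑ i, p i = 1) :
    softmax (fun i => Real.log (p i)) = p := by
  funext i
  simp [softmax, Real.exp_log (hp _), hp1]

/-- The normalizing constants drop out, as the vector `softmax z - softmax w` has sum `0`. -/
theorem sum_softmax_sub_mul_log (z w : ι → ℝ) :
    ∑ i, (softmax z i - softmax w i) * (Real.log (softmax z i) - Real.log (softmax w i)) =
      ∑ i, (softmax z i - softmax w i) * (z i - w i) := by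
  have h : ∑ i, (softmax z i - softmax w i) *
      (Real.log (∑ j, Real.exp (w j)) - Real.log (∑ j, Real.exp (z j))) = 0 := by
    rw [← Finset.sum_mul, Finset.sum_sub_distrib, sum_softmax, sum_softmax]; simp
  rw [← sub_eq_zero, ← Finset.sum_sub_distrib, ← h]
  refine Finset.sum_congr rfl fun i _ => ?_
  rw [log_softmax, log_softmax]; ring

theorem sum_abs_softmax_sub_le {z w : ι → ℝ} {m : ℝ} (h : ∀ i, |z i - w i| ≤ m) :
    ∑ i, |softmax z i - softmax w i| ≤ 2 * m := by
  have h1 := sq_sum_abs_sub_le_relEntropy (softmax_pos z) (softmax_pos w) (sum_softmax z)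
    (sum_softmax w)
  have h2 := sq_sum_abs_sub_le_relEntropy (softmax_pos w) (softmax_pos z) (sum_softmax w)
    (sum_softmax z)
  simp only [abs_sub_comm (softmax w _)] at h2
  have h3 := relEntropy_add_relEntropy (softmax z) (softmax w)
  rw [sum_softmax_sub_mul_log] at h3
  have h4 : ∑ i, (softmax z i - softmax w i) * (z i - w i) ≤
      (∑ i, |softmax z i - softmax w i|) * m := by
    rw [Finset.sum_mul]
    refine Finset.sum_le_sum fun i _ => (le_abs_self _).trans ?_
    rw [abs_mul]
    exact mul_le_mul_of_nonneg_left (h i) (abs_nonneg _)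
  have h5 : 0 ≤ ∑ i, |softmax z i - softmax w i| := Finset.sum_nonneg fun _ _ => abs_nonneg _
  have h6 : 0 ≤ m := (abs_nonneg _).trans (h (Classical.arbitrary ι))
  by_contra! hlt
  nlinarith

theorem contDiff_softmax {n : WithTop ℕ∞} : ContDiff ℝ n (softmax : (ι → ℝ) → ι → ℝ) := by
  refine contDiff_pi.2 fun i => ?_
  unfold softmax
  refine ContDiff.div (by fun_prop) (by fun_prop) fun z => (sum_exp_pos z).ne'

theorem hasDerivAt_softmax {z : ℝ → ι → ℝ} {z' : ι → ℝ} {t : ℝ} (h : HasDerivAt z z' t) (i : ι) :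
    HasDerivAt (fun s => softmax (z s) i)
      (softmax (z t) i * (z' i - ∑ j, softmax (z t) j * z' j)) t := by
  have hz : ∀ j, HasDerivAt (fun s => z s j) (z' j) t := hasDerivAt_pi.1 h
  have hs : HasDerivAt (fun s => ∑ j, Real.exp (z s j)) (∑ j, Real.exp (z t j) * z' j) t :=
    HasDerivAt.fun_sum fun j _ => (hz j).exp
  have hne := (sum_exp_pos (z t)).ne'
  refine ((hz i).exp.div hs hne).congr_deriv ?_
  have : ∑ j, softmax (z t) j * z' j =
      (∑ j, Real.exp (z t j) * z' j) / ∑ j, Real.exp (z t j) := by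
    rw [Finset.sum_div]
    exact Finset.sum_congr rfl fun j _ => by rw [softmax]; ring
  rw [this, softmax]
  field_simp

end Softmax

end Entropy

/-! ### Global solutions and exponential decay -/

open scoped Manifold ContDiff in
/-- By Picard–Lindelöf the local solutions of a globally Lipschitz equation live for a time that
does not depend on the initial value, hence they extend to all times. -/
theorem exists_forall_hasDerivAt_of_lipschitzWith {E : Type*} [NormedAddCommGroup E]
    [NormedSpace ℝ E] [CompleteSpace E] {F : E → E} {K : NNReal} (hC : ContDiff ℝ 1 F)
    (hK : LipschitzWith K F) (x₀ : E) :
    ∃ z : ℝ → E, z 0 = x₀ ∧ ∀ t, HasDerivAt z (F (z t)) t := by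
  set ε : ℝ := 1 / (K + 1) with hε
  have hεpos : 0 < ε := by positivity
  have hloc : ∀ x : E, ∃ γ : ℝ → E, γ 0 = x ∧
      IsMIntegralCurveOn (I := 𝓘(ℝ, E)) γ F (Set.Ioo (-ε) ε) := by
    intro x
    have hmem : (0 : ℝ) ∈ Set.Icc (-ε) ε := ⟨by linarith, hεpos.le⟩
    -- on the ball of radius `a = ‖F x‖ + 1` the field is bounded by `‖F x‖ + K * a ≤ (K + 1) * a`
    have hP : IsPicardLindelof (fun _ => F) (⟨0, hmem⟩ : Set.Icc (-ε) ε) x (‖F x‖₊ + 1) 0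
        (‖F x‖₊ + K * (‖F x‖₊ + 1)) K := by
      refine IsPicardLindelof.of_time_independent ?_ hK.lipschitzOnWith ?_
      · intro y hy
        have h1 := hK.dist_le_mul y x
        rw [Metric.mem_closedBall] at hy
        rw [dist_eq_norm] at h1
        have h2 : ‖F y‖ ≤ ‖F x‖ + ‖F y - F x‖ := by
          simpa using norm_add_le (F x) (F y - F x)
        have h3 := mul_le_mul_of_nonneg_left hy K.coe_nonneg
        push_cast at h3 ⊢
        linarith
      · push_cast
        have h0 : max (ε - 0) (0 - -ε) = ε := by simp
        rw [h0, hε, mul_one_div, div_le_iff₀ (by positivity)]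
        have := norm_nonneg (F x)
        nlinarith [K.coe_nonneg]
    obtain ⟨γ, h0, hγ⟩ := hP.exists_eq_forall_mem_Icc_hasDerivWithinAt
      (x := x) (by simp)
    refine ⟨γ, h0, fun t ht => ?_⟩
    have hd := (hγ t (Set.Ioo_subset_Icc_self ht)).hasDerivAt (Icc_mem_nhds ht.1 ht.2)
    exact hd.hasFDerivAt.hasMFDerivAt.hasMFDerivWithinAt
  have hv : ContMDiff 𝓘(ℝ, E) 𝓘(ℝ, E).tangent 1
      (fun x => (⟨x, F x⟩ : TangentBundle 𝓘(ℝ, E) E)) :=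
    contMDiff_vectorSpace_iff_contDiff.2 hC
  obtain ⟨z, hz0, hz⟩ := exists_isMIntegralCurve_of_isMIntegralCurveOn hv hεpos hloc x₀
  refine ⟨z, hz0, fun t => ?_⟩
  have h : HasFDerivAt z ((1 : ℝ →L[ℝ] ℝ).smulRight (F (z t)) : ℝ →L[ℝ] E) t :=
    hasMFDerivAt_iff_hasFDerivAt.1 (hz t)
  simpa using h.hasDerivAt

/-- If, among finitely many nonnegative functions, each one decays at the rate `lam` whenever it is
the largest, then all of them tend to `0`: none can be the first one to reach the barrier
`C * exp (-(lam / 2) * t)`. -/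
theorem tendsto_zero_of_deriv_le_at_max {ι : Type*} [Finite ι] {f f' : ι → ℝ → ℝ} {lam : ℝ}
    (hlam : 0 < lam) (hf0 : ∀ a t, 0 ≤ t → 0 ≤ f a t)
    (hf : ∀ a t, 0 ≤ t → HasDerivWithinAt (f a) (f' a t) (Set.Ici 0) t)
    (hdecay : ∀ a t, 0 ≤ t → (∀ b, f b t ≤ f a t) → f' a t ≤ -lam * f a t) (a : ι) :
    Tendsto (f a) atTop (𝓝 0) := by
  obtain ⟨M, hM⟩ := (Set.finite_range fun b => f b 0).bddAbove
  set C := max M 0 + 1 with hC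
  have hCpos : 0 < C := by positivity
  set φ : ℝ → ℝ := fun t => C * Real.exp (-(lam / 2) * t) with hφ
  have hφpos : ∀ t, 0 < φ t := fun t => mul_pos hCpos (Real.exp_pos _)
  have hφd : ∀ t, HasDerivAt φ (-(lam / 2) * φ t) t := by
    intro t
    have h1 : HasDerivAt (fun s : ℝ => -(lam / 2) * s) (-(lam / 2)) t := by
      simpa using (hasDerivAt_id t).const_mul (-(lam / 2))
    exact (h1.exp.const_mul C).congr_deriv (by simp only [hφ]; ring)
  have hcont : ∀ b, ContinuousOn (fun t => f b t - φ t) (Set.Ici 0) := fun b t ht =>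
    ((hf b t ht).continuousWithinAt).sub (hφd t).continuousAt.continuousWithinAt
  have hlt : ∀ t, 0 ≤ t → ∀ b, f b t < φ t := by
    by_contra! hcon
    obtain ⟨t₁, ht₁, b₁, hb₁⟩ := hcon
    set B : Set ℝ := ⋃ b, Set.Icc 0 t₁ ∩ (fun t => f b t - φ t) ⁻¹' Set.Ici 0 with hB
    have hBc : IsCompact B := by
      refine isCompact_iUnion fun b => ?_
      exact isCompact_Icc.of_isClosed_subset
        (((hcont b).mono Set.Icc_subset_Ici_self).preimage_isClosed_of_isClosed isClosed_Icc
          isClosed_Ici) Set.inter_subset_left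
    have hBne : B.Nonempty :=
      ⟨t₁, Set.mem_iUnion.2 ⟨b₁, ⟨ht₁, le_rfl⟩, by simpa using hb₁⟩⟩
    obtain ⟨τ, hτB, hτ⟩ := hBc.exists_isLeast hBne
    obtain ⟨b, ⟨⟨hτ0, hτ1⟩, hbτ⟩⟩ := Set.mem_iUnion.1 hτB
    have hbτ' : φ τ ≤ f b τ := by simpa using hbτ
    have hbefore : ∀ t, 0 ≤ t → t < τ → ∀ d, f d t < φ t := by
      intro t ht htτ d
      by_contra! h
      exact absurd (hτ (Set.mem_iUnion.2 ⟨d, ⟨ht, htτ.le.trans hτ1⟩, by simpa using h⟩))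
        (not_le.2 htτ)
    have hτpos : 0 < τ := by
      rcases hτ0.lt_or_eq with h | h
      · exact h
      · exfalso
        have h1 : f b 0 ≤ M := hM ⟨b, rfl⟩
        rw [← h] at hbτ'
        have h2 : φ 0 = C := by simp [hφ]
        have := le_max_left M 0
        linarith
    have hnhds : Set.Ici (0 : ℝ) ∈ 𝓝 τ := Ici_mem_nhds hτpos
    have hev : ∀ᶠ t in 𝓝[<] τ, 0 < t ∧ t < τ := by
      filter_upwards [Ioo_mem_nhdsLT hτpos] with t ht using ht
    have hle : ∀ d, f d τ ≤ φ τ := by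
      intro d
      have h1 : Tendsto (fun t => f d t - φ t) (𝓝[<] τ) (𝓝 (f d τ - φ τ)) :=
        (((hcont d).continuousAt hnhds).tendsto).mono_left nhdsWithin_le_nhds
      have h2 := le_of_tendsto h1 (b := 0) (hev.mono fun t ht => by
        linarith [hbefore t ht.1.le ht.2 d])
      linarith
    have heq : f b τ = φ τ := le_antisymm (hle b) hbτ'
    have hd : HasDerivAt (fun t => f b t - φ t) (f' b τ - -(lam / 2) * φ τ) τ :=
      ((hf b τ hτ0).hasDerivAt hnhds).sub (hφd τ)
    have hneg : f' b τ - -(lam / 2) * φ τ < 0 := by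
      have h1 := hdecay b τ hτ0 fun d => heq ▸ hle d
      rw [heq] at h1
      nlinarith [hφpos τ, mul_pos hlam (hφpos τ)]
    -- the difference is negative before `τ` and vanishes at `τ`, so its slope there is nonnegative
    have hslope : Tendsto (slope (fun t => f b t - φ t) τ) (𝓝[<] τ)
        (𝓝 (f' b τ - -(lam / 2) * φ τ)) :=
      (hasDerivAt_iff_tendsto_slope.1 hd).mono_left (nhdsWithin_mono τ fun t ht => ne_of_lt ht)
    refine absurd (ge_of_tendsto hslope (b := 0) (hev.mono fun t ht => ?_)) (not_le.2 hneg)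
    have h1 := hbefore t ht.1.le ht.2 b
    rw [slope_def_field, heq]
    exact div_nonneg_of_nonpos (by linarith) (by linarith [ht.2])
  have hφt : Tendsto φ atTop (𝓝 0) := by
    have h1 : Tendsto (fun t : ℝ => -(lam / 2) * t) atTop atBot :=
      tendsto_id.const_mul_atTop_of_neg (by linarith)
    simpa only [mul_zero, Function.comp_def] using (Real.tendsto_exp_atBot.comp h1).const_mul C
  refine tendsto_of_tendsto_of_tendsto_of_le_of_le' tendsto_const_nhds hφt ?_ ?_
  · filter_upwards [eventually_ge_atTop 0] with t ht using hf0 a t ht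
  · filter_upwards [eventually_ge_atTop 0] with t ht using (hlt t ht a).le

theorem exists_pos_forall_le {ι : Type*} [Finite ι] {f : ι → ℝ} (hf : ∀ a, 0 < f a) :
    ∃ ε > 0, ∀ a, ε ≤ f a := by
  rcases isEmpty_or_nonempty ι with h | h
  · exact ⟨1, one_pos, fun a => isEmptyElim a⟩
  · obtain ⟨a, ha⟩ := Finite.exists_min f
    exact ⟨f a, hf a, ha⟩

namespace NetworkGame

section Dynamics

variable {V : Type*} [Fintype V] {S : V → Type*} [∀ k, Fintype (S k)]
  (g : NetworkGame V S) [DecidableRel g.graph.Adj] {T : V → ℝ}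

/-! ### The dynamics in logit coordinates -/

/-- The rewards of all agents, as a linear function of the joint strategy. -/
def rewardMap : (∀ k, S k → ℝ) →ₗ[ℝ] (∀ k, S k → ℝ) where
  toFun x k i := g.reward k x i
  map_add' x y := by
    funext k i
    simp [reward, Matrix.mulVec_add, Finset.sum_add_distrib]
  map_smul' a x := by
    funext k i
    simp [reward, Matrix.mulVec_smul, Finset.mul_sum]

theorem reward_sub (x y : ∀ k, S k → ℝ) (k : V) (i : S k) :
    g.reward k (x - y) i = g.reward k x i - g.reward k y i :=
  congrFun (congrFun (g.rewardMap.map_sub x y) k) i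

theorem exists_lipschitzWith_rewardMap : ∃ K, LipschitzWith K g.rewardMap :=
  ⟨_, (LinearMap.toContinuousLinearMap g.rewardMap).lipschitz⟩

theorem contDiff_rewardMap {n : WithTop ℕ∞} : ContDiff ℝ n g.rewardMap :=
  (LinearMap.toContinuousLinearMap g.rewardMap).contDiff

variable [∀ k, Nonempty (S k)]

theorem lipschitzWith_softmax_pi :
    LipschitzWith 2 fun (z : ∀ k, S k → ℝ) k => softmax (z k) := by
  refine LipschitzWith.of_dist_le_mul fun z w => ?_
  refine (dist_pi_le_iff (by positivity)).2 fun k => (dist_pi_le_iff (by positivity)).2 fun i => ?_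
  have h := sum_abs_softmax_sub_le (z := z k) (w := w k) (m := dist z w) fun j => by
    rw [← Real.dist_eq]
    exact (dist_le_pi_dist (z k) (w k) j).trans (dist_le_pi_dist z w k)
  rw [Real.dist_eq]
  exact (Finset.single_le_sum (f := fun i => |softmax (z k) i - softmax (w k) i|)
    (fun _ _ => abs_nonneg _) (Finset.mem_univ i)).trans h

/-- In the coordinates `z` with `x k = softmax (z k)`, the Q-Learning dynamics become
`ż = r(softmax z) - T z`, whose right-hand side is globally Lipschitz. -/
theorem exists_isQLDSolution {x₀ : ∀ k, S k → ℝ} (hx₀ : IsInteriorStrategy x₀) :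
    ∃ x, g.IsQLDSolution T x ∧ x 0 = x₀ := by
  let L : (∀ k, S k → ℝ) →ₗ[ℝ] (∀ k, S k → ℝ) :=
    { toFun := fun z k i => T k * z k i
      map_add' := fun x y => by funext k i; simp [mul_add]
      map_smul' := fun a x => by funext k i; simp [mul_left_comm] }
  obtain ⟨K, hK⟩ := g.exists_lipschitzWith_rewardMap
  have hC : ContDiff ℝ 1 fun z : ∀ k, S k → ℝ => g.rewardMap (fun k => softmax (z k)) - L z := by
    refine ContDiff.sub (g.contDiff_rewardMap.comp (contDiff_pi.2 fun k => ?_))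
      (LinearMap.toContinuousLinearMap L).contDiff
    exact contDiff_softmax.comp (contDiff_pi.1 contDiff_id k)
  obtain ⟨z, hz0, hz⟩ := exists_forall_hasDerivAt_of_lipschitzWith hC
    ((hK.comp lipschitzWith_softmax_pi).sub (LinearMap.toContinuousLinearMap L).lipschitz)
    fun k i => Real.log (x₀ k i)
  refine ⟨fun t k => softmax (z t k), fun t _ => ⟨fun k => ⟨softmax_pos _, sum_softmax _⟩,
    fun k i => ?_⟩, ?_⟩
  · refine ((hasDerivAt_softmax (hasDerivAt_pi.1 (hz t) k) i).congr_deriv ?_).hasDerivWithinAt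
    have h1 : ∀ j, Real.log (softmax (z t k) j / softmax (z t k) i) = z t k j - z t k i := by
      intro j
      rw [Real.log_div (softmax_pos _ _).ne' (softmax_pos _ _).ne', log_softmax, log_softmax]
      ring
    simp only [qldField, h1]
    congr 1
    simp only [Pi.sub_apply, rewardMap, L, LinearMap.coe_mk, AddHom.coe_mk, mul_sub,
      Finset.sum_sub_distrib, ← Finset.sum_mul, sum_softmax, mul_left_comm _ (T k),
      ← Finset.mul_sum]
    ring
  · funext k
    simp only [hz0]
    exact softmax_log (hx₀ k).1 (hx₀ k).2

/-! ### Equilibria and the dissipation of relative entropy -/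

theorem isQRE_iff {x : ∀ k, S k → ℝ} :
    g.IsQRE T x ↔ ∀ k, x k = softmax fun i => g.reward k x i / T k := by
  refine ⟨fun h k => funext fun i => h.2 k i, fun h => ⟨fun k => ?_, fun k i => congrFun (h k) i⟩⟩
  rw [h k]
  exact ⟨fun i => (softmax_pos _ i).le, sum_softmax _⟩

variable {g}

theorem IsQRE.isInteriorStrategy {x : ∀ k, S k → ℝ} (h : g.IsQRE T x) :
    IsInteriorStrategy x := by
  intro k
  rw [g.isQRE_iff.1 h k]
  exact ⟨softmax_pos _, sum_softmax _⟩

theorem IsQRE.exists_mul_log_eq {x : ∀ k, S k → ℝ} (hT : ∀ k, 0 < T k) (h : g.IsQRE T x) (k : V) :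
    ∃ c, ∀ i, T k * Real.log (x k i) = g.reward k x i - c := by
  refine ⟨T k * Real.log (∑ j, Real.exp (g.reward k x j / T k)), fun i => ?_⟩
  rw [congrFun (g.isQRE_iff.1 h k) i, log_softmax, mul_sub, mul_div_cancel₀ _ (hT k).ne']

theorem IsQRE.isQLDSolution_const {x : ∀ k, S k → ℝ} (hT : ∀ k, 0 < T k) (h : g.IsQRE T x) :
    g.IsQLDSolution T fun _ => x := by
  refine fun t _ => ⟨h.isInteriorStrategy, fun k i => ?_⟩
  have hpos := (h.isInteriorStrategy k).1
  obtain ⟨c, hc⟩ := h.exists_mul_log_eq hT k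
  have h1 : T k * ∑ j, x k j * Real.log (x k j / x k i) =
      ∑ j, x k j * (g.reward k x j - g.reward k x i) := by
    rw [Finset.mul_sum]
    refine Finset.sum_congr rfl fun j _ => ?_
    rw [Real.log_div (hpos j).ne' (hpos i).ne']
    linear_combination x k j * (hc j - hc i)
  have h2 : g.qldField T x k i = 0 := by
    simp only [qldField, h1, mul_sub, Finset.sum_sub_distrib, ← Finset.sum_mul,
      (h.isInteriorStrategy k).2]
    ring
  rw [h2]
  exact hasDerivWithinAt_const _ _ _

theorem IsQRE.hasDerivWithinAt_relEntropy {y : ∀ k, S k → ℝ} {x : ℝ → ∀ k, S k → ℝ}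
    (hT : ∀ k, 0 < T k) (hy : g.IsQRE T y) (hx : g.IsQLDSolution T x) (k : V) {t : ℝ}
    (ht : 0 ≤ t) :
    HasDerivWithinAt (fun s => relEntropy (y k) (x s k))
      (∑ i, (x t k i - y k i) * (g.reward k (x t) i - g.reward k y i) -
        T k * (relEntropy (y k) (x t k) + relEntropy (x t k) (y k))) (Set.Ici 0) t := by
  obtain ⟨hint, hd⟩ := hx t ht
  obtain ⟨hpos, hsum⟩ := hint k
  have hysum := (hy.isInteriorStrategy k).2
  obtain ⟨c, hc⟩ := hy.exists_mul_log_eq hT k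
  have h1 : HasDerivWithinAt (fun s => relEntropy (y k) (x s k))
      (∑ i, y k i * (0 - g.qldField T (x t) k i / x t k i)) (Set.Ici 0) t :=
    HasDerivWithinAt.fun_sum fun i _ => (((hasDerivWithinAt_const _ _ _).sub
      ((hd k i).log (hpos i).ne')).const_mul _)
  refine h1.congr_deriv ?_
  have h2 : ∀ i, y k i * (0 - g.qldField T (x t) k i / x t k i) =
      y k i * (∑ j, x t k j * g.reward k (x t) j - T k * ∑ j, x t k j * Real.log (x t k j)) -
        y k i * (g.reward k (x t) i - T k * Real.log (x t k i)) := by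
    intro i
    have h3 : ∑ j, x t k j * Real.log (x t k j / x t k i) =
        ∑ j, x t k j * Real.log (x t k j) - Real.log (x t k i) := by
      simp only [Real.log_div (hpos _).ne' (hpos i).ne', mul_sub, Finset.sum_sub_distrib,
        ← Finset.sum_mul, hsum, one_mul]
    rw [qldField, h3, mul_div_cancel_left₀ _ (hpos i).ne']
    ring
  have h4 : ∑ i, (x t k i - y k i) * (g.reward k y i - T k * Real.log (y k i)) = 0 := by
    have : ∀ i, g.reward k y i - T k * Real.log (y k i) = c := fun i => by rw [hc i]; ring
    simp only [this, ← Finset.sum_mul, Finset.sum_sub_distrib, hsum, hysum, sub_self, zero_mul]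
  rw [relEntropy_add_relEntropy, Finset.sum_congr rfl fun i _ => h2 i, Finset.sum_sub_distrib,
    ← Finset.sum_mul, hysum, one_mul, Finset.mul_sum, Finset.mul_sum, ← Finset.sum_sub_distrib,
    ← Finset.sum_sub_distrib, ← Finset.sum_sub_distrib, ← sub_eq_zero, ← Finset.sum_sub_distrib,
    ← h4]
  exact Finset.sum_congr rfl fun i _ => by ring

theorem tendsto_of_tendsto_relEntropy {y : ∀ k, S k → ℝ} {x : ℝ → ∀ k, S k → ℝ}
    (hy : g.IsQRE T y) (hx : g.IsQLDSolution T x)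
    (h : ∀ k, Tendsto (fun t => relEntropy (y k) (x t k)) atTop (𝓝 0)) :
    Tendsto x atTop (𝓝 y) := by
  refine tendsto_pi_nhds.2 fun k => tendsto_pi_nhds.2 fun i => ?_
  have h1 : Tendsto (fun t => √(4 * relEntropy (y k) (x t k))) atTop (𝓝 0) := by
    simpa using ((h k).const_mul 4).sqrt
  rw [tendsto_iff_dist_tendsto_zero]
  refine squeeze_zero' (Eventually.of_forall fun _ => dist_nonneg) ?_ h1
  filter_upwards [eventually_ge_atTop 0] with t ht
  have hint := (hx t ht).1 k
  have hyint := hy.isInteriorStrategy k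
  rw [dist_comm, Real.dist_eq]
  refine (Finset.single_le_sum (f := fun i => |y k i - x t k i|)
    (fun _ _ => abs_nonneg _) (Finset.mem_univ i)).trans (Real.le_sqrt_of_sq_le ?_)
  exact sq_sum_abs_sub_le_relEntropy hyint.1 hint.1 hyint.2 hint.2

/-- An equilibrium that attracts every solution is unique, since equilibria are themselves
(constant) solutions. -/
theorem IsQRE.convergesToUniqueQRE {y : ∀ k, S k → ℝ} (hT : ∀ k, 0 < T k) (hy : g.IsQRE T y)
    (h : ∀ x, g.IsQLDSolution T x → ∀ k, Tendsto (fun t => relEntropy (y k) (x t k)) atTop (𝓝 0)) :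
    g.QLDConvergesToUniqueQRE T :=
  ⟨y, hy, fun _ hy' => tendsto_nhds_unique tendsto_const_nhds
      (tendsto_of_tendsto_relEntropy hy (hy'.isQLDSolution_const hT)
        (h _ (hy'.isQLDSolution_const hT))),
    fun _ hx₀ => g.exists_isQLDSolution hx₀,
    fun x hx => tendsto_of_tendsto_relEntropy hy hx (h x hx)⟩

end Dynamics

section Criteria

variable {V : Type*} [Fintype V] {S : V → Type*} [∀ k, Fintype (S k)] [∀ k, Nonempty (S k)]
  {g : NetworkGame V S} [DecidableRel g.graph.Adj] {T : V → ℝ}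

/-! ### Rewards that respond weakly to the other agents -/

/-- If the rewards move by at most `κ k / 2` times the `ℓ¹` distance of the strategies, then the
logit best response is a contraction in the coordinates `z` with `x k = softmax (z k)`. -/
theorem exists_isQRE_of_abs_reward_sub_le {κ : V → ℝ} (hκ0 : ∀ k, 0 ≤ κ k)
    (hκT : ∀ k, κ k < T k)
    (hκ : ∀ (x y : ∀ k, S k → ℝ) (m : ℝ), IsInteriorStrategy x → IsInteriorStrategy y →
      (∀ l, ∑ j, |x l j - y l j| ≤ m) →
      ∀ k i, |g.reward k x i - g.reward k y i| ≤ κ k / 2 * m) :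
    ∃ x, g.IsQRE T x := by
  have hT : ∀ k, 0 < T k := fun k => (hκ0 k).trans_lt (hκT k)
  obtain ⟨ε, hε, hεk⟩ := exists_pos_forall_le (f := fun k => 1 - κ k / T k) fun k =>
    sub_pos.2 ((div_lt_one (hT k)).2 (hκT k))
  set q : NNReal := ⟨max 0 (1 - ε), le_max_left _ _⟩ with hq
  have hq1 : q < 1 := by
    rw [← NNReal.coe_lt_coe]
    exact max_lt one_pos (by rw [NNReal.coe_one]; linarith)
  have hqk : ∀ k, κ k / T k ≤ q := fun k =>
    le_trans (by linarith [hεk k]) (le_max_right 0 (1 - ε))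
  let Φ : (∀ k, S k → ℝ) → ∀ k, S k → ℝ := fun z k i =>
    g.reward k (fun l => softmax (z l)) i / T k
  have hΦ : ContractingWith q Φ := by
    refine ⟨hq1, LipschitzWith.of_dist_le_mul fun z w => ?_⟩
    refine (dist_pi_le_iff (by positivity)).2 fun k =>
      (dist_pi_le_iff (by positivity)).2 fun i => ?_
    have h1 := hκ (fun l => softmax (z l)) (fun l => softmax (w l)) (2 * dist z w)
      (fun l => ⟨softmax_pos _, sum_softmax _⟩) (fun l => ⟨softmax_pos _, sum_softmax _⟩)
      (fun l => sum_abs_softmax_sub_le fun j => by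
        rw [← Real.dist_eq]
        exact (dist_le_pi_dist (z l) (w l) j).trans (dist_le_pi_dist z w l)) k i
    rw [Real.dist_eq, ← sub_div, abs_div, abs_of_pos (hT k)]
    calc _ ≤ κ k / 2 * (2 * dist z w) / T k := by gcongr; exact (hT k).le
      _ = κ k / T k * dist z w := by ring
      _ ≤ q * dist z w := by gcongr; exact hqk k
  refine ⟨fun l => softmax (hΦ.fixedPoint Φ l), g.isQRE_iff.2 fun k => ?_⟩
  change softmax (hΦ.fixedPoint Φ k) = softmax (Φ (hΦ.fixedPoint Φ) k)
  rw [hΦ.fixedPoint_isFixedPt.eq]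

/-- The largest of the relative entropies `relEntropy (y k) (x k)` decays exponentially. -/
theorem convergesToUniqueQRE_of_abs_reward_sub_le {κ : V → ℝ} (hκ0 : ∀ k, 0 ≤ κ k)
    (hκT : ∀ k, κ k < T k)
    (hκ : ∀ (x y : ∀ k, S k → ℝ) (m : ℝ), IsInteriorStrategy x → IsInteriorStrategy y →
      (∀ l, ∑ j, |x l j - y l j| ≤ m) →
      ∀ k i, |g.reward k x i - g.reward k y i| ≤ κ k / 2 * m) :
    g.QLDConvergesToUniqueQRE T := by
  have hT : ∀ k, 0 < T k := fun k => (hκ0 k).trans_lt (hκT k)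
  obtain ⟨y, hy⟩ := exists_isQRE_of_abs_reward_sub_le hκ0 hκT hκ
  have hyint := hy.isInteriorStrategy
  obtain ⟨ε, hε, hεk⟩ := exists_pos_forall_le (f := fun k => T k - κ k) fun k =>
    sub_pos.2 (hκT k)
  refine hy.convergesToUniqueQRE hT fun x hx => ?_
  refine tendsto_zero_of_deriv_le_at_max hε
    (fun k t ht => relEntropy_nonneg (hyint k).1 ((hx t ht).1 k).1 (hyint k).2 ((hx t ht).1 k).2)
    (fun k t ht => hy.hasDerivWithinAt_relEntropy hT hx k ht) fun k t ht hmax => ?_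
  have hint := (hx t ht).1
  set E := relEntropy (y k) (x t k) with hE
  set E' := relEntropy (x t k) (y k) with hE'
  have hE0 : 0 ≤ E := relEntropy_nonneg (hyint k).1 (hint k).1 (hyint k).2 (hint k).2
  have hE'0 : 0 ≤ E' := relEntropy_nonneg (hint k).1 (hyint k).1 (hint k).2 (hyint k).2
  set a := ∑ i, |x t k i - y k i| with ha
  have ha2 : a ^ 2 ≤ 4 * E' :=
    sq_sum_abs_sub_le_relEntropy (hint k).1 (hyint k).1 (hint k).2 (hyint k).2
  have hm : ∀ l, ∑ j, |x t l j - y l j| ≤ √(4 * E) := by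
    intro l
    refine Real.le_sqrt_of_sq_le ?_
    simp only [abs_sub_comm (x t l _)]
    refine (sq_sum_abs_sub_le_relEntropy (hyint l).1 (hint l).1 (hyint l).2 (hint l).2).trans ?_
    linarith [hmax l]
  have hr : ∑ i, (x t k i - y k i) * (g.reward k (x t) i - g.reward k y i) ≤
      a * (κ k / 2 * √(4 * E)) := by
    rw [ha, Finset.sum_mul]
    refine Finset.sum_le_sum fun i _ => (le_abs_self _).trans ?_
    rw [abs_mul]
    exact mul_le_mul_of_nonneg_left (hκ _ _ _ hint hyint hm k i) (abs_nonneg _)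
  have hm2 : √(4 * E) ^ 2 = 4 * E := Real.sq_sqrt (by linarith)
  have ham : a * √(4 * E) ≤ 2 * (E + E') := by nlinarith [sq_nonneg (a - √(4 * E))]
  have h1 : a * (κ k / 2 * √(4 * E)) ≤ κ k * (E + E') := by
    nlinarith [mul_le_mul_of_nonneg_left ham (hκ0 k)]
  have h2 : ε * (E + E') ≤ (T k - κ k) * (E + E') :=
    mul_le_mul_of_nonneg_right (hεk k) (by linarith)
  nlinarith [mul_nonneg hε.le hE'0]

/-! ### Rewards with a one-sided bound -/

/-- The perturbed equilibrium depends in a Lipschitz way on the perturbation `b`, uniformly in the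
strength `s` of the interaction. -/
theorem dist_le_of_eq_softmax {c ε : ℝ} (hc0 : 0 ≤ c) (hε : 0 < ε) (hεk : ∀ k, ε ≤ T k - c)
    (hc : ∀ d : ∀ k, S k → ℝ, ∑ k, ∑ i, d k i * g.reward k d i ≤ c * ∑ k, ∑ i, d k i ^ 2)
    {s : ℝ} (hs0 : 0 ≤ s) (hs1 : s ≤ 1) {b b' x x' : ∀ k, S k → ℝ}
    (hx : ∀ k, x k = softmax fun i => (s * g.reward k x i + b k i) / T k)
    (hx' : ∀ k, x' k = softmax fun i => (s * g.reward k x' i + b' k i) / T k) :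
    dist x x' ≤ (∑ k, (Fintype.card (S k) : ℝ)) / ε * dist b b' := by
  have hT : ∀ k, 0 < T k := fun k => by linarith [hεk k]
  set N : ℝ := ∑ k, (Fintype.card (S k) : ℝ) with hN
  have hN0 : 0 ≤ N := Finset.sum_nonneg fun _ _ => Nat.cast_nonneg _
  set Q : V → ℝ := fun k => ∑ i, (x k i - x' k i) ^ 2 with hQ
  have hQ0 : ∀ k, 0 ≤ Q k := fun k => Finset.sum_nonneg fun _ _ => sq_nonneg _
  have hk : ∀ k, T k * Q k ≤ s * ∑ i, (x - x') k i * g.reward k (x - x') i +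
      ∑ i, (x k i - x' k i) * (b k i - b' k i) := by
    intro k
    have h1 : Q k ≤ ∑ i, (x k i - x' k i) * (Real.log (x k i) - Real.log (x' k i)) := by
      simp only [hQ]
      rw [hx k, hx' k]
      exact sum_sq_sub_le_sum_mul_log (softmax_pos _) (softmax_pos _) (sum_softmax _)
        (sum_softmax _)
    refine (mul_le_mul_of_nonneg_left h1 (hT k).le).trans_eq ?_
    have h2 := sum_softmax_sub_mul_log (fun i => (s * g.reward k x i + b k i) / T k)
      (fun i => (s * g.reward k x' i + b' k i) / T k)
    rw [← hx k, ← hx' k] at h2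
    rw [h2, Finset.mul_sum, Finset.mul_sum, ← Finset.sum_add_distrib]
    refine Finset.sum_congr rfl fun i _ => ?_
    rw [reward_sub, Pi.sub_apply, Pi.sub_apply]
    have := (hT k).ne'
    field_simp
    ring
  have hm : ∀ k i, |x k i - x' k i| ≤ dist x x' := fun k i => by
    rw [← Real.dist_eq]
    exact (dist_le_pi_dist (x k) (x' k) i).trans (dist_le_pi_dist x x' k)
  have hb : ∀ k i, |b k i - b' k i| ≤ dist b b' := fun k i => by
    rw [← Real.dist_eq]
    exact (dist_le_pi_dist (b k) (b' k) i).trans (dist_le_pi_dist b b' k)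
  have hcross : ∑ k, ∑ i, (x k i - x' k i) * (b k i - b' k i) ≤ N * (dist x x' * dist b b') := by
    calc _ ≤ ∑ k, ∑ _i : S k, dist x x' * dist b b' := by
          refine Finset.sum_le_sum fun k _ => Finset.sum_le_sum fun i _ => ?_
          refine (le_abs_self _).trans ?_
          rw [abs_mul]
          exact mul_le_mul (hm k i) (hb k i) (abs_nonneg _) dist_nonneg
      _ = _ := by
          simp only [Finset.sum_const, Finset.card_univ, nsmul_eq_mul, ← Finset.sum_mul, hN]
  have hsum := Finset.sum_le_sum fun k (_ : k ∈ Finset.univ) => hk k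
  rw [Finset.sum_add_distrib, ← Finset.mul_sum] at hsum
  have hcQ : s * ∑ k, ∑ i, (x - x') k i * g.reward k (x - x') i ≤ c * ∑ k, Q k := by
    have h1 := hc (x - x')
    have h2 : 0 ≤ c * ∑ k, Q k := mul_nonneg hc0 (Finset.sum_nonneg fun k _ => hQ0 k)
    calc _ ≤ s * (c * ∑ k, Q k) := mul_le_mul_of_nonneg_left h1 hs0
      _ ≤ 1 * (c * ∑ k, Q k) := mul_le_mul_of_nonneg_right hs1 h2
      _ = _ := one_mul _
  have hεQ : ε * ∑ k, Q k ≤ N * (dist x x' * dist b b') := by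
    have h1 : ε * ∑ k, Q k ≤ ∑ k, T k * Q k - c * ∑ k, Q k := by
      rw [Finset.mul_sum, Finset.mul_sum, ← Finset.sum_sub_distrib]
      refine Finset.sum_le_sum fun k _ => ?_
      rw [← sub_mul]
      exact mul_le_mul_of_nonneg_right (hεk k) (hQ0 k)
    linarith
  set m := dist x x' with hmdef
  have hm0 : 0 ≤ m := dist_nonneg
  have hsq : m ≤ √(N / ε * dist b b' * m) := by
    refine (dist_pi_le_iff (Real.sqrt_nonneg _)).2 fun k =>
      (dist_pi_le_iff (Real.sqrt_nonneg _)).2 fun i => ?_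
    rw [Real.dist_eq]
    refine Real.abs_le_sqrt ?_
    have h1 : (x k i - x' k i) ^ 2 ≤ ∑ k, Q k :=
      (Finset.single_le_sum (f := fun i => (x k i - x' k i) ^ 2)
        (fun _ _ => sq_nonneg _) (Finset.mem_univ i)).trans
        (Finset.single_le_sum (f := Q) (fun k _ => hQ0 k) (Finset.mem_univ k))
    rw [div_mul_eq_mul_div, div_mul_eq_mul_div, le_div_iff₀ hε]
    nlinarith
  have hK0 : 0 ≤ N / ε * dist b b' := by positivity
  rcases hm0.eq_or_lt with h0 | h0
  · rw [← h0]; exact hK0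
  · have h1 := (Real.le_sqrt' h0).1 hsq
    rw [sq] at h1
    exact le_of_mul_le_mul_right h1 h0

/-- Existence by the method of continuity: the strength `s` of the interaction is increased from
`0`, where the problem is explicit, to `1` in steps so small that, by `dist_le_of_eq_softmax`,
each of them is a contraction. -/
theorem exists_isQRE_of_sum_mul_reward_le {c : ℝ} (hc0 : 0 ≤ c) (hcT : ∀ k, c < T k)
    (hc : ∀ d : ∀ k, S k → ℝ, ∑ k, ∑ i, d k i * g.reward k d i ≤ c * ∑ k, ∑ i, d k i ^ 2) :
    ∃ x, g.IsQRE T x := by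
  obtain ⟨ε, hε, hεk⟩ := exists_pos_forall_le (f := fun k => T k - c) fun k => sub_pos.2 (hcT k)
  obtain ⟨K, hK⟩ := g.exists_lipschitzWith_rewardMap
  set M : ℝ := (∑ k, (Fintype.card (S k) : ℝ)) / ε with hM
  have hM0 : 0 ≤ M := div_nonneg (Finset.sum_nonneg fun _ _ => Nat.cast_nonneg _) hε.le
  obtain ⟨n, hn⟩ := exists_nat_gt (M * K)
  have hn1 : (0 : ℝ) < n + 1 := by positivity
  set h : ℝ := 1 / (n + 1) with hh
  have hh0 : 0 ≤ h := by positivity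
  have hstep : ∀ j : ℕ, j ≤ n + 1 → ∀ b : ∀ k, S k → ℝ, ∃ x : ∀ k, S k → ℝ,
      ∀ k, x k = softmax fun i => (j * h * g.reward k x i + b k i) / T k := by
    intro j
    induction j with
    | zero => exact fun _ b => ⟨fun k => softmax fun i => b k i / T k, fun k => by simp⟩
    | succ j ih =>
      intro hj b
      choose X hX using ih (by omega)
      have hjh : (j : ℝ) * h ≤ 1 := by
        rw [hh, mul_one_div, div_le_one hn1]
        exact_mod_cast (by omega : j ≤ n + 1)
      set q : NNReal := ⟨M * (h * K), by positivity⟩ with hq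
      have hΦ : ContractingWith q fun x => X (b + h • g.rewardMap x) := by
        refine ⟨?_, LipschitzWith.of_dist_le_mul fun x y => ?_⟩
        · rw [← NNReal.coe_lt_coe]
          change M * (h * K) < 1
          rw [hh, mul_left_comm, one_div_mul_eq_div, div_lt_one hn1]
          linarith
        · refine (dist_le_of_eq_softmax hc0 hε hεk hc (by positivity) hjh (hX _) (hX _)).trans ?_
          change M * _ ≤ M * (h * K) * _
          rw [dist_add_left, dist_smul₀, Real.norm_of_nonneg hh0, mul_assoc, mul_assoc]
          gcongr
          exact hK.dist_le_mul x y
      refine ⟨hΦ.fixedPoint _, fun k => ?_⟩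
      have h1 := hX (b + h • g.rewardMap (hΦ.fixedPoint _)) k
      rw [hΦ.fixedPoint_isFixedPt.eq] at h1
      refine h1.trans (congrArg softmax (funext fun i => ?_))
      simp only [Pi.add_apply, Pi.smul_apply, smul_eq_mul, rewardMap, LinearMap.coe_mk,
        AddHom.coe_mk, Nat.cast_succ]
      ring
  obtain ⟨x, hx⟩ := hstep (n + 1) le_rfl 0
  refine ⟨x, g.isQRE_iff.2 fun k => (hx k).trans (congrArg softmax (funext fun i => ?_))⟩
  have h1 : ((n + 1 : ℕ) : ℝ) * h = 1 := by
    rw [hh, mul_one_div]; push_cast; exact div_self hn1.ne'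
  rw [h1]
  simp

/-- The sum of the relative entropies `relEntropy (y k) (x k)` decays exponentially. -/
theorem convergesToUniqueQRE_of_sum_mul_reward_le {c : ℝ} (hc0 : 0 ≤ c) (hcT : ∀ k, c < T k)
    (hc : ∀ d : ∀ k, S k → ℝ, ∑ k, ∑ i, d k i * g.reward k d i ≤ c * ∑ k, ∑ i, d k i ^ 2) :
    g.QLDConvergesToUniqueQRE T := by
  have hT : ∀ k, 0 < T k := fun k => hc0.trans_lt (hcT k)
  obtain ⟨y, hy⟩ := exists_isQRE_of_sum_mul_reward_le hc0 hcT hc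
  have hyint := hy.isInteriorStrategy
  obtain ⟨ε, hε, hεk⟩ := exists_pos_forall_le (f := fun k => T k - c) fun k => sub_pos.2 (hcT k)
  refine hy.convergesToUniqueQRE hT fun x hx k => ?_
  have hE0 : ∀ k t, 0 ≤ t → 0 ≤ relEntropy (y k) (x t k) := fun k t ht =>
    relEntropy_nonneg (hyint k).1 ((hx t ht).1 k).1 (hyint k).2 ((hx t ht).1 k).2
  have hsum : Tendsto (fun t => ∑ k, relEntropy (y k) (x t k)) atTop (𝓝 0) := by
    refine tendsto_zero_of_deriv_le_at_max (ι := Unit)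
      (f := fun _ t => ∑ k, relEntropy (y k) (x t k)) hε
      (fun _ t ht => Finset.sum_nonneg fun k _ => hE0 k t ht)
      (fun _ t ht => HasDerivWithinAt.fun_sum fun k _ =>
        hy.hasDerivWithinAt_relEntropy hT hx k ht) (fun _ t ht _ => ?_) ()
    have hint := (hx t ht).1
    have h1 : ∀ k, ∑ i, (x t k i - y k i) ^ 2 ≤
        relEntropy (y k) (x t k) + relEntropy (x t k) (y k) := fun k => by
      rw [relEntropy_add_relEntropy]
      exact sum_sq_sub_le_sum_mul_log (hint k).1 (hyint k).1 (hint k).2 (hyint k).2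
    have h2 := hc (x t - y)
    simp only [reward_sub, Pi.sub_apply] at h2
    rw [Finset.sum_sub_distrib]
    have h3 : ∑ k, (ε * relEntropy (y k) (x t k) + c * ∑ i, (x t k i - y k i) ^ 2) ≤
        ∑ k, T k * (relEntropy (y k) (x t k) + relEntropy (x t k) (y k)) := by
      refine Finset.sum_le_sum fun k _ => ?_
      have h4 : 0 ≤ relEntropy (x t k) (y k) :=
        relEntropy_nonneg (hint k).1 (hyint k).1 (hint k).2 (hyint k).2
      have h5 := hE0 k t ht
      nlinarith [mul_le_mul_of_nonneg_left (h1 k) hc0, mul_nonneg hε.le h4,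
        mul_le_mul_of_nonneg_right (hεk k) (add_nonneg h5 h4)]
    rw [Finset.sum_add_distrib, ← Finset.mul_sum, ← Finset.mul_sum] at h3
    linarith
  refine squeeze_zero' ?_ ?_ hsum
  · filter_upwards [eventually_ge_atTop 0] with t ht using hE0 k t ht
  · filter_upwards [eventually_ge_atTop 0] with t ht
    exact Finset.single_le_sum (f := fun k => relEntropy (y k) (x t k))
      (fun k _ => hE0 k t ht) (Finset.mem_univ k)

end Criteria

end NetworkGame

/-! ### Bounds by the influence bound and by the intensity of identical interests -/

/-- The inner product of a vector of sum `0` only sees the oscillation of the other vector. -/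
theorem abs_sum_mul_le_of_sum_eq_zero {ι : Type*} [Fintype ι] [Nonempty ι] {a d : ι → ℝ} {δ : ℝ}
    (ha : ∀ i j, |a i - a j| ≤ δ) (hd : ∑ i, d i = 0) :
    |∑ i, a i * d i| ≤ δ / 2 * ∑ i, |d i| := by
  obtain ⟨p, hp⟩ := Finite.exists_max a
  obtain ⟨q, hq⟩ := Finite.exists_min a
  have h1 : ∑ i, a i * d i = ∑ i, (a i - (a p + a q) / 2) * d i := by
    simp only [sub_mul, Finset.sum_sub_distrib, ← Finset.mul_sum, hd, mul_zero, sub_zero]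
  rw [h1, Finset.mul_sum]
  refine (Finset.abs_sum_le_sum_abs _ _).trans (Finset.sum_le_sum fun i _ => ?_)
  rw [abs_mul]
  refine mul_le_mul_of_nonneg_right ?_ (abs_nonneg _)
  have h2 := (abs_le.1 (ha p q)).2
  rw [abs_le]
  constructor <;> linarith [hp i, hq i]

theorem abs_dotProduct_mulVec_le {m n : Type*} [Fintype m] [Fintype n] [DecidableEq n]
    (M : Matrix m n ℝ) (u : m → ℝ) (v : n → ℝ) :
    |u ⬝ᵥ (M *ᵥ v)| ≤ matrixTwoNorm M * (‖WithLp.toLp 2 u‖ * ‖WithLp.toLp 2 v‖) := by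
  have h1 : u ⬝ᵥ (M *ᵥ v) =
      inner ℝ (LinearMap.toContinuousLinearMap (Matrix.toEuclideanLin M) (WithLp.toLp 2 v))
        (WithLp.toLp 2 u) := by
    simp [Matrix.toEuclideanLin, EuclideanSpace.inner_eq_star_dotProduct]
  rw [h1]
  refine (abs_real_inner_le_norm _ _).trans ?_
  have h2 := (LinearMap.toContinuousLinearMap (Matrix.toEuclideanLin M)).le_opNorm
    (WithLp.toLp 2 v)
  unfold matrixTwoNorm
  calc _ ≤ _ := mul_le_mul_of_nonneg_right h2 (norm_nonneg _)
    _ = _ := by ring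

theorem dotProduct_mulVec_le_matrixInfNorm {m : Type*} [Fintype m] {M : Matrix m m ℝ}
    (hM : M.IsSymm) (u : m → ℝ) : u ⬝ᵥ (M *ᵥ u) ≤ matrixInfNorm M * ∑ i, u i ^ 2 := by
  have h1 : u ⬝ᵥ (M *ᵥ u) = ∑ i, ∑ j, M i j * (u i * u j) := by
    simp only [dotProduct, Matrix.mulVec, Finset.mul_sum]
    exact Finset.sum_congr rfl fun i _ => Finset.sum_congr rfl fun j _ => by ring
  have h2 : ∀ i j, M i j * (u i * u j) ≤ |M i j| * (u i ^ 2 / 2) + |M j i| * (u j ^ 2 / 2) := by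
    intro i j
    rw [hM.apply i j]
    calc M i j * (u i * u j) ≤ |M i j| * |u i * u j| := (le_abs_self _).trans (abs_mul _ _).le
      _ ≤ |M i j| * ((u i ^ 2 + u j ^ 2) / 2) := by
        refine mul_le_mul_of_nonneg_left ?_ (abs_nonneg _)
        rw [abs_le]
        constructor <;> nlinarith [sq_nonneg (u i - u j), sq_nonneg (u i + u j)]
      _ = _ := by ring
  rw [h1]
  calc _ ≤ ∑ i, ∑ j, (|M i j| * (u i ^ 2 / 2) + |M j i| * (u j ^ 2 / 2)) :=
        Finset.sum_le_sum fun i _ => Finset.sum_le_sum fun j _ => h2 i j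
    _ = ∑ i, (∑ j, |M i j|) * u i ^ 2 := by
        simp only [Finset.sum_add_distrib]
        rw [Finset.sum_comm (f := fun i j => |M j i| * (u j ^ 2 / 2)), ← Finset.sum_add_distrib]
        refine Finset.sum_congr rfl fun i _ => ?_
        rw [← Finset.sum_mul]
        ring
    _ ≤ _ := by
        rw [Finset.mul_sum]
        exact Finset.sum_le_sum fun i _ => mul_le_mul_of_nonneg_right
          (le_ciSup (f := fun i => ∑ j, |M i j|) (Set.finite_range _).bddAbove i) (sq_nonneg _)

theorem dotProduct_mulVec_le_matrixTwoNorm {m : Type*} [Fintype m] [DecidableEq m]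
    (M : Matrix m m ℝ) (u : m → ℝ) : u ⬝ᵥ (M *ᵥ u) ≤ matrixTwoNorm M * ∑ i, u i ^ 2 := by
  refine (le_abs_self _).trans ((abs_dotProduct_mulVec_le M u u).trans_eq ?_)
  rw [← sq, EuclideanSpace.real_norm_sq_eq]

namespace NetworkGame

section Bounds

variable {V : Type*} [Fintype V] {S : V → Type*} [∀ k, Fintype (S k)] [∀ k, DecidableEq (S k)]
  (g : NetworkGame V S) [DecidableRel g.graph.Adj]

theorem influenceBound_nonneg (k : V) : 0 ≤ g.influenceBound k := by
  refine Real.sSup_nonneg ?_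
  rintro _ ⟨i, a, b, l, -, -, rfl⟩
  exact abs_nonneg _

theorem abs_payoffMatrix_sub_le [∀ k, Nonempty (S k)] {k l : V}
    (h : g.graph.Adj k l) (i : S k) (j j' : S l) :
    |g.payoffMatrix k l i j - g.payoffMatrix k l i j'| ≤ g.influenceBound k := by
  classical
  set a : ∀ m, S m := Function.update (fun m => Classical.arbitrary (S m)) l j with ha
  set b : ∀ m, S m := Function.update (fun m => Classical.arbitrary (S m)) l j' with hb
  have hab : ∀ m, m ≠ l → a m = b m := fun m hm => by
    rw [ha, hb, Function.update_of_ne hm, Function.update_of_ne hm]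
  have hsub : g.payoffMatrix k l i j - g.payoffMatrix k l i j' =
      g.reward k (fun m => Pi.single (a m) 1) i - g.reward k (fun m => Pi.single (b m) 1) i := by
    simp only [reward, Matrix.mulVec_single_one, ← Finset.sum_sub_distrib, Matrix.col_apply]
    rw [Finset.sum_eq_single l (fun m _ hm => by rw [hab m hm, sub_self])
      fun hl => absurd ((g.graph.mem_neighborFinset k l).2 h) hl]
    simp [ha, hb]
  rw [hsub]
  refine le_csSup ?_ ⟨i, a, b, l, h, hab, rfl⟩
  refine ((Set.finite_range fun p : S k × (∀ m, S m) × (∀ m, S m) =>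
    |g.reward k (fun m => Pi.single (p.2.1 m) 1) p.1 -
      g.reward k (fun m => Pi.single (p.2.2 m) 1) p.1|).subset ?_).bddAbove
  rintro _ ⟨i, a, b, l, -, -, rfl⟩
  exact ⟨(i, a, b), rfl⟩

theorem abs_reward_sub_le_influenceBound [∀ k, Nonempty (S k)]
    {x y : ∀ k, S k → ℝ} {m : ℝ} (hx : IsInteriorStrategy x) (hy : IsInteriorStrategy y)
    (hm : ∀ l, ∑ j, |x l j - y l j| ≤ m) (k : V) (i : S k) :
    |g.reward k x i - g.reward k y i| ≤ g.influenceBound k * g.graph.degree k / 2 * m := by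
  have h1 : ∀ l ∈ g.graph.neighborFinset k,
      |(g.payoffMatrix k l *ᵥ x l) i - (g.payoffMatrix k l *ᵥ y l) i| ≤
        g.influenceBound k / 2 * m := by
    intro l hl
    rw [SimpleGraph.mem_neighborFinset] at hl
    have h2 := abs_sum_mul_le_of_sum_eq_zero (d := fun j => x l j - y l j)
      (g.abs_payoffMatrix_sub_le hl i) (by rw [Finset.sum_sub_distrib, (hx l).2, (hy l).2, sub_self])
    simp only [Matrix.mulVec, dotProduct, ← Finset.sum_sub_distrib, ← mul_sub]
    exact h2.trans (mul_le_mul_of_nonneg_left (hm l) (by linarith [g.influenceBound_nonneg k]))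
  rw [reward, reward, ← Finset.sum_sub_distrib]
  refine (Finset.abs_sum_le_sum_abs _ _).trans ((Finset.sum_le_sum h1).trans_eq ?_)
  rw [Finset.sum_const, SimpleGraph.card_neighborFinset_eq_degree, nsmul_eq_mul]
  ring

omit [Fintype V] [DecidableRel g.graph.Adj] in
theorem identicalInterest_nonneg : 0 ≤ g.identicalInterest := by
  refine Real.sSup_nonneg ?_
  rintro _ ⟨k, l, -, rfl⟩
  exact norm_nonneg _

omit [DecidableRel g.graph.Adj] in
theorem matrixTwoNorm_le_identicalInterest {k l : V} (h : g.graph.Adj k l) :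
    matrixTwoNorm (g.payoffMatrix k l + (g.payoffMatrix l k)ᵀ) ≤ g.identicalInterest := by
  refine le_csSup ?_ ⟨k, l, h, rfl⟩
  refine ((Set.finite_range fun p : V × V => matrixTwoNorm
    (g.payoffMatrix p.1 p.2 + (g.payoffMatrix p.2 p.1)ᵀ)).subset ?_).bddAbove
  rintro _ ⟨k, l, -, rfl⟩
  exact ⟨(k, l), rfl⟩

/-- Only the sums `A^{kl} + (A^{lk})ᵀ` contribute to `∑ k, ⟨d k, r_k(d)⟩`, so that it is bounded by
the quadratic form of the adjacency matrix at the Euclidean norms of the `d k`. -/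
theorem sum_mul_reward_le (d : ∀ k, S k → ℝ) :
    ∑ k, ∑ i, d k i * g.reward k d i ≤ 1 / 2 * g.identicalInterest *
      ((fun k => ‖WithLp.toLp 2 (d k)‖) ⬝ᵥ
        (g.graph.adjMatrix ℝ *ᵥ fun k => ‖WithLp.toLp 2 (d k)‖)) := by
  set n : V → ℝ := fun k => ‖WithLp.toLp 2 (d k)‖ with hn
  set G := g.graph.adjMatrix ℝ with hG
  set w : V → V → ℝ := fun k l => d k ⬝ᵥ (g.payoffMatrix k l *ᵥ d l) with hw
  have h1 : ∑ k, ∑ i, d k i * g.reward k d i = ∑ k, ∑ l, G k l * w k l := by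
    refine Finset.sum_congr rfl fun k _ => ?_
    rw [← payoff_eq, payoff]
    simp only [hG, SimpleGraph.adjMatrix_apply, ite_mul, one_mul, zero_mul]
    rw [← Finset.sum_filter, SimpleGraph.neighborFinset_eq_filter]
  have h2 : ∑ k, ∑ l, G k l * w k l = 1 / 2 * ∑ k, ∑ l, G k l * (w k l + w l k) := by
    have h3 : ∑ k, ∑ l, G k l * w l k = ∑ k, ∑ l, G k l * w k l := by
      rw [Finset.sum_comm]
      refine Finset.sum_congr rfl fun k _ => Finset.sum_congr rfl fun l _ => ?_
      simp only [hG, SimpleGraph.adjMatrix_apply, g.graph.adj_comm]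
    simp only [mul_add, Finset.sum_add_distrib]
    rw [h3]
    ring
  have h4 : ∀ k l, G k l * (w k l + w l k) ≤ g.identicalInterest * (n k * (G k l * n l)) := by
    intro k l
    simp only [hG, SimpleGraph.adjMatrix_apply]
    split_ifs with h
    · have h5 : w k l + w l k =
          d k ⬝ᵥ ((g.payoffMatrix k l + (g.payoffMatrix l k)ᵀ) *ᵥ d l) := by
        simp only [hw, Matrix.add_mulVec, dotProduct_add]
        rw [Matrix.mulVec_transpose, Matrix.dotProduct_mulVec (d l),
          dotProduct_comm (d k) (d l ᵥ* _)]
      rw [one_mul, one_mul, h5]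
      refine (le_abs_self _).trans ((abs_dotProduct_mulVec_le _ _ _).trans ?_)
      exact mul_le_mul_of_nonneg_right (g.matrixTwoNorm_le_identicalInterest h)
        (mul_nonneg (norm_nonneg _) (norm_nonneg _))
    · simp
  have h6 : n ⬝ᵥ (G *ᵥ n) = ∑ k, ∑ l, n k * (G k l * n l) := by
    simp only [dotProduct, Matrix.mulVec, Finset.mul_sum]
  rw [h1, h2, h6, mul_assoc]
  refine mul_le_mul_of_nonneg_left ?_ (by norm_num)
  rw [Finset.mul_sum]
  refine Finset.sum_le_sum fun k _ => ?_
  rw [Finset.mul_sum]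
  exact Finset.sum_le_sum fun l _ => h4 k l

/-- Any bound for the quadratic form of the adjacency matrix gives a convergence threshold. -/
theorem convergesToUniqueQRE_of_adjMatrix_le [∀ k, Nonempty (S k)] {T : V → ℝ} {ν : ℝ}
    (hν0 : 0 ≤ ν) (hν : ∀ u : V → ℝ, u ⬝ᵥ (g.graph.adjMatrix ℝ *ᵥ u) ≤ ν * ∑ k, u k ^ 2)
    (hT : ∀ k, 1 / 2 * g.identicalInterest * ν < T k) : g.QLDConvergesToUniqueQRE T := by
  have hσ : 0 ≤ 1 / 2 * g.identicalInterest := by linarith [g.identicalInterest_nonneg]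
  refine convergesToUniqueQRE_of_sum_mul_reward_le (mul_nonneg hσ hν0) hT fun d => ?_
  refine (g.sum_mul_reward_le d).trans ?_
  have h1 := mul_le_mul_of_nonneg_left (hν fun k => ‖WithLp.toLp 2 (d k)‖) hσ
  simp only [EuclideanSpace.real_norm_sq_eq] at h1
  linarith

end Bounds

end NetworkGame

theorem theorem1 {V : Type*} [Fintype V] [DecidableEq V] {S : V → Type*}
    [∀ k, Fintype (S k)] [∀ k, DecidableEq (S k)] [∀ k, Nonempty (S k)]
    (g : NetworkGame V S) [DecidableRel g.graph.Adj] (T : V → ℝ) :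
    ((∀ k, T k > g.influenceBound k * (g.graph.degree k : ℝ)) →
      g.QLDConvergesToUniqueQRE T) ∧
    ((∀ k, T k > 1 / 2 * g.identicalInterest * matrixInfNorm (g.graph.adjMatrix ℝ)) →
      g.QLDConvergesToUniqueQRE T) ∧
    (g.SameBimatrixGame →
      (∀ k, T k > 1 / 2 * g.identicalInterest * matrixTwoNorm (g.graph.adjMatrix ℝ)) →
      g.QLDConvergesToUniqueQRE T) := by
  refine ⟨fun hT => ?_, fun hT => ?_, fun _ hT => ?_⟩
  · exact NetworkGame.convergesToUniqueQRE_of_abs_reward_sub_le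
      (fun k => mul_nonneg (g.influenceBound_nonneg k) (Nat.cast_nonneg _)) hT
      fun x y m hx hy hm k i => g.abs_reward_sub_le_influenceBound hx hy hm k i
  · exact g.convergesToUniqueQRE_of_adjMatrix_le
      (Real.iSup_nonneg fun _ => Finset.sum_nonneg fun _ _ => abs_nonneg _)
      (dotProduct_mulVec_le_matrixInfNorm (g.graph.isSymm_adjMatrix)) hT
  · exact g.convergesToUniqueQRE_of_adjMatrix_le (norm_nonneg _)
      (dotProduct_mulVec_le_matrixTwoNorm _) hT
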